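/- **Setting.** Let $\psi_1,\dots,\psi_n:\mathbf R^d\to\mathbf R^d$ be affine maps, let $G\subset\mathbf R^d$ be a set, and suppose that the following hold. - (F1) The $\psi_i$ are diffeomorphisms of class $C^{1,\nu_0}$ for some $\nu_0\in(0,1]$, with a common Lipschitz constant $\eta<1$, and $G$ is the (unique) nonempty compact set with $G=\bigcup_{i=1}^n\psi_i(G)$. - (F2) For $i\ne j$ the set $\psi_i(G)\cap\psi_j(G)$ is finite. Put $\mathcal F=\bigcup_{i\neq j}\psi_i(G)\cap\psi_j(G)$. - (F3) Let $\Sigma=\{1,\dots,n\}^{\mathbf N}$ with the product topology, let $\sigma$ be the left shift, and let $\Phi:\Sigma\to G$ be the coding map, where $\Phi(x_0x_1\dots)$ is the single point of $\bigcap_{l\ge0}\psi_{x_0}\circ\dots\circ\psi_{x_l}(G)$. Then $\bigcup_{j\ge1}\sigma^j(\Phi^{-1}(\mathcal F))$ is finite. - (F4) There are disjoint open sets $\mathcal O_1,\dots,\mathcal O_n\subset\mathbf R^d$ with $G\cap\mathcal O_i=\psi_i(G)\setminus\mathcal F$ for every $i$. - (ND) There is $b>0$ such that for all $v,v_0\in\mathbf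 R^d$ and all $p\in G$ there is $i$ with $|(D\psi_i(p)v,v_0)|\ge b\,\|v\|\,\|v_0\|$. **Notation.** Let $M^d$ be the space of symmetric $d\times d$ matrices, ordered by $X\le Y$ if $Y-X$ is positive semidefinite, and let $(A,B)_{HS}=\mathrm{tr}({}^tA\,B)$. For a countably additive matrix-valued Borel measure $\tau$ on $\Sigma$ and a continuous $A:\Sigma\to M^d$, let $\int_\Sigma(A,d\tau)_{HS}$ be the real integral defined by this pairing. The Ruelle operator on $C(\Sigma,M^d)$ is $$(\mathcal L_\Sigma A)(x)=\sum_{i=1}^n{}^tD\psi_i|_{\Phi(x)}\,A(ix)\,D\psi_i|_{\Phi(x)},$$ where $ix$ is the sequence $i\,x_0x_1\dots$. Its adjoint $\mathcal L_\Sigma^*$ acts on measures by $\int_\Sigma(A,d\mathcal L^*_\Sigma\tau)_{HS}=\int_\Sigma(\mathcal L_\Sigma A,d\tau)_{HS}$ for all $A\in C(\Sigma,M^d)$. For $x\in\Sigma$ let $[x_0\dots x_l]=\{y\in\Sigma: y_i=x_i,\ 0\le i\le l\}$ and $\psi_{x_0\dots x_l}=\psi_{x_0}\circ\dots\circ\psi_{x_l}$.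 Since these maps are affine, their derivatives do not depend on the point. **Eigendata.** Let $\beta>0$, let $Q:\Sigma\to M^d$ be continuous with $Q_x$ positive definite for every $x$ and $\mathcal L_\Sigma Q=\beta Q$, and let $\tau_\Sigma$ be a matrix-valued Borel measure on $\Sigma$, all of whose values are symmetric positive semidefinite, with $\int_\Sigma(Q,d\tau_\Sigma)_{HS}=1$ and $\mathcal L_\Sigma^*\tau_\Sigma=\beta\tau_\Sigma$. **Claim.** For all $l\ge0$ and all $x=(x_0x_1\dots)\in\Sigma$: 1. $\displaystyle\tau_\Sigma([x_0\dots x_l])=\beta^{-1}\,D\psi_{x_0}\,\tau_\Sigma([x_1\dots x_l])\,{}^tD\psi_{x_0}$, where for $l=0$ the set $[x_1\dots x_l]$ is read as $\Sigma$. 2. $\displaystyle\tau_\Sigma([x_0\dots x_l])=\beta^{-(l+1)}\,D\psi_{x_0\dots x_l}\,\tau_\Sigma(\Sigma)\,{}^tD\psi_{x_0\dots x_l}$. 3. $\tau_\Sigma$ is a matrix-valued Gibbs measure with constant $C=\log\beta$. That is, there is $D_1>0$ such that for all $l\ge1$ and all $x\in\Sigma$, $$e^{-Cl-D_1}\,D\psi_{x_0\dots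 x_{l-1}}\,\tau_\Sigma(\Sigma)\,{}^tD\psi_{x_0\dots x_{l-1}}\le\tau_\Sigma([x_0\dots x_{l-1}])\le e^{-Cl+D_1}\,D\psi_{x_0\dots x_{l-1}}\,\tau_\Sigma(\Sigma)\,{}^tD\psi_{x_0\dots x_{l-1}}.$$ -/

import Mathlib

open MeasureTheory Set Function
open scoped NNReal InnerProduct

noncomputable section

/-- Euclidean `d`-space. -/
abbrev Euc (d : ℕ) := EuclideanSpace ℝ (Fin d)

/-- Real `d × d` matrices, as linear maps of Euclidean `d`-space. The transpose of `A` is the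
adjoint `A†`, and the matrix product is the composition `A ∘L B`. -/
abbrev Mat (d : ℕ) := Euc d →L[ℝ] Euc d

/-- The one-sided shift space of sequences `x₀ x₁ x₂ …` over `n` symbols, with the product
topology and the product (that is, Borel) sigma-algebra. -/
abbrev ShiftSpace (n : ℕ) := ℕ → Fin n

/-- The left shift `x₀ x₁ x₂ … ↦ x₁ x₂ x₃ …`. -/
def leftShift {n : ℕ} (x : ShiftSpace n) : ShiftSpace n := fun k => x (k + 1)

/-- The sequence `i x₀ x₁ x₂ …`. -/
def prepend {n : ℕ} (i : Fin n) (x : ShiftSpace n) : ShiftSpace n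
  | 0 => i
  | k + 1 => x k

/-- The cylinder of all sequences that agree with `x` on the first `l` symbols. The cylinder
`[x₀ … x_l]` is `cyl x (l + 1)`, and `[x₁ … x_l]` is `cyl (leftShift x) l`. -/
def cyl {n : ℕ} (x : ShiftSpace n) (l : ℕ) : Set (ShiftSpace n) :=
  PiNat.cylinder (E := fun _ => Fin n) x l

/-- `wordMap ψ x l = ψ_{x₀} ∘ … ∘ ψ_{x_{l-1}}`, the composition over the first `l` symbols. -/
def wordMap {d n : ℕ} (ψ : Fin n → Euc d → Euc d) (x : ShiftSpace n) : ℕ → Euc d → Euc d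
  | 0 => id
  | l + 1 => wordMap ψ x l ∘ ψ (x l)

/-! ### The fractal -/

/-- Finitely many diffeomorphisms of class `C^{1,ν₀}`, with a common Lipschitz constant smaller
than one. -/
def IsContractiveSystem {d n : ℕ} (ψ : Fin n → Euc d → Euc d) : Prop :=
  (∃ ν₀ : ℝ≥0, 0 < ν₀ ∧ ν₀ ≤ 1 ∧ ∀ i, ContDiff ℝ 1 (ψ i) ∧
      (∃ C : ℝ≥0, HolderWith C ν₀ (fderiv ℝ (ψ i))) ∧
      ∃ g : Euc d → Euc d, ContDiff ℝ 1 g ∧ LeftInverse g (ψ i) ∧ RightInverse g (ψ i)) ∧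
  ∃ η : ℝ≥0, η < 1 ∧ ∀ i, LipschitzWith η (ψ i)

/-- `G` is the fractal generated by `ψ`: the nonempty compact set with `G = ⋃ᵢ ψᵢ(G)`, which is
unique if `ψ` is a contractive system. -/
def IsAttractor {d n : ℕ} (ψ : Fin n → Euc d → Euc d) (G : Set (Euc d)) : Prop :=
  IsCompact G ∧ G.Nonempty ∧ G = ⋃ i, ψ i '' G

/-- The points of the fractal that lie in two different first-level cells. -/
def overlapSet {d n : ℕ} (ψ : Fin n → Euc d → Euc d) (G : Set (Euc d)) : Set (Euc d) :=
  {p | ∃ i j, i ≠ j ∧ p ∈ ψ i '' G ∩ ψ j '' G}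

/-- The coding map: the image of the sequence `x` is the point of
`⋂ₗ ψ_{x₀} ∘ … ∘ ψ_{x_{l-1}} (G)`. -/
def codingMap {d n : ℕ} (ψ : Fin n → Euc d → Euc d) (G : Set (Euc d)) (x : ShiftSpace n) :
    Euc d :=
  Classical.epsilon fun p => ∀ l, p ∈ wordMap ψ x l '' G

/-- For a contractive system, `⋂ₗ ψ_{x₀} ∘ … ∘ ψ_{x_{l-1}} (G)` is a single point. -/
theorem existsUnique_coding {d n : ℕ} (ψ : Fin n → Euc d → Euc d) (G : Set (Euc d))
    (hψ : IsContractiveSystem ψ) (hG : IsAttractor ψ G) (x : ShiftSpace n) :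
    ∃! p, ∀ l, p ∈ wordMap ψ x l '' G := by
  obtain ⟨-, η, hη, hL⟩ := hψ
  obtain ⟨hc, hne, hGe⟩ := hG
  have hlip : ∀ l, LipschitzWith (η ^ l) (wordMap ψ x l) := by
    intro l
    induction l with
    | zero => simpa [wordMap] using LipschitzWith.id
    | succ l ih => simpa [wordMap, pow_succ] using ih.comp (hL (x l))
  have hcl : ∀ l, IsCompact (wordMap ψ x l '' G) := fun l => hc.image (hlip l).continuous
  have hsub : ∀ i, ψ i '' G ⊆ G := fun i => by
    conv_rhs => rw [hGe]
    exact Set.subset_iUnion (fun i => ψ i '' G) i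
  obtain ⟨p, hp⟩ := IsCompact.nonempty_iInter_of_sequence_nonempty_isCompact_isClosed
    (fun l => wordMap ψ x l '' G)
    (fun l => by
      simp only [wordMap, Set.image_comp]
      exact Set.image_mono (hsub _)) (fun l => hne.image _) (hcl 0) (fun l => (hcl l).isClosed)
  rw [Set.mem_iInter] at hp
  refine ⟨p, hp, fun q hq => ?_⟩
  obtain ⟨M, hM⟩ := (Metric.isBounded_iff.1 hc.isBounded)
  have hb : ∀ l, dist q p ≤ (η : ℝ) ^ l * M := fun l => by
    obtain ⟨a, ha, rfl⟩ := hq l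
    obtain ⟨b, hb, hbp⟩ := hp l
    rw [← hbp]
    refine ((hlip l).dist_le_mul a b).trans ?_
    push_cast
    gcongr
    exact hM ha hb
  have ht : Filter.Tendsto (fun l : ℕ => (η : ℝ) ^ l * M) Filter.atTop (nhds (0 * M)) :=
    (tendsto_pow_atTop_nhds_zero_of_lt_one η.2 (by exact_mod_cast hη)).mul_const M
  have := ge_of_tendsto' ht hb
  rw [zero_mul] at this
  exact dist_le_zero.1 this

/-- The coding map picks the point of the intersection. -/
theorem codingMap_spec {d n : ℕ} (ψ : Fin n → Euc d → Euc d) (G : Set (Euc d))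
    (hψ : IsContractiveSystem ψ) (hG : IsAttractor ψ G) (x : ShiftSpace n) :
    ∀ l, codingMap ψ G x ∈ wordMap ψ x l '' G :=
  Classical.epsilon_spec (existsUnique_coding ψ G hψ hG x).exists

/-- Two different first-level cells meet in finitely many points. -/
def HasFiniteOverlaps {d n : ℕ} (ψ : Fin n → Euc d → Euc d) (G : Set (Euc d)) : Prop :=
  ∀ i j, i ≠ j → (ψ i '' G ∩ ψ j '' G).Finite

/-- Post-critical finiteness: the codings of the overlap points have, together, only finitely many
proper forward iterates under the shift. -/
def IsPostCriticallyFinite {d n : ℕ} (ψ : Fin n → Euc d → Euc d) (G : Set (Euc d)) : Prop :=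
  (⋃ j : ℕ, leftShift^[j + 1] '' (codingMap ψ G ⁻¹' overlapSet ψ G)).Finite

/-- The first-level cells, without the overlap points, are cut out of `G` by disjoint open sets. -/
def HasSeparatingOpens {d n : ℕ} (ψ : Fin n → Euc d → Euc d) (G : Set (Euc d)) : Prop :=
  ∃ O : Fin n → Set (Euc d), (∀ i, IsOpen (O i)) ∧ (∀ i j, i ≠ j → Disjoint (O i) (O j)) ∧
    ∀ i, G ∩ O i = ψ i '' G \ overlapSet ψ G

/-- The nondegeneracy condition, in its quantitative form. -/
def IsNondegenerate {d n : ℕ} (ψ : Fin n → Euc d → Euc d) (G : Set (Euc d)) : Prop :=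
  ∃ b : ℝ, 0 < b ∧ ∀ v v₀ : Euc d, ∀ p ∈ G, ∃ i, b * ‖v‖ * ‖v₀‖ ≤ |inner ℝ (fderiv ℝ (ψ i) p v) v₀|

/-- Every `ψᵢ` is an affine map. -/
def IsAffineSystem {d n : ℕ} (ψ : Fin n → Euc d → Euc d) : Prop :=
  ∀ i, ∃ f : Euc d →ᵃ[ℝ] Euc d, ∀ p, f p = ψ i p

/-! ### Matrix-valued measures and the Ruelle operator -/

/-- The Hilbert-Schmidt inner product `(A, B) = tr (ᵗA B)`, as a continuous bilinear map. -/
def hsInner (d : ℕ) : Mat d →L[ℝ] Mat d →L[ℝ] ℝ :=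
  (LinearMap.mk₂ ℝ (fun A B : Mat d => LinearMap.trace ℝ (Euc d) (A† ∘L B).toLinearMap)
    (by intros; simp [ContinuousLinearMap.add_comp]) (by intros; simp)
    (by intros; simp [ContinuousLinearMap.comp_add]) (by intros; simp)).toContinuousBilinearMap

theorem hsInner_apply (d : ℕ) (A B : Mat d) :
    hsInner d A B = LinearMap.trace ℝ (Euc d) (A† ∘L B).toLinearMap := rfl

/-- Countably additive matrix-valued Borel measures on the shift space. -/
abbrev MatMeasure (n d : ℕ) := VectorMeasure (ShiftSpace n) (Mat d)

/-- The real number `∫ (A, dτ)_HS`. -/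
def hsIntegral {n d : ℕ} (A : ShiftSpace n → Mat d) (τ : MatMeasure n d) : ℝ :=
  τ.integral A (hsInner d)

/-- The measures all of whose values are symmetric positive semidefinite matrices. -/
def IsPosMeasure {n d : ℕ} (τ : MatMeasure n d) : Prop :=
  ∀ B, MeasurableSet B → (τ B).IsPositive

/-- The Ruelle operator on the shift:
`(𝓛 A)(x) = ∑ᵢ ᵗDψᵢ(Φ(x)) A(i x) Dψᵢ(Φ(x))`, with `Φ` the coding map. -/
def ruelle {n d : ℕ} (ψ : Fin n → Euc d → Euc d) (G : Set (Euc d)) (A : ShiftSpace n → Mat d) :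
    ShiftSpace n → Mat d :=
  fun x => ∑ i,
    (fderiv ℝ (ψ i) (codingMap ψ G x))† ∘L A (prepend i x) ∘L fderiv ℝ (ψ i) (codingMap ψ G x)

/-- `τ'` is the image of `τ` under the adjoint of the Ruelle operator, for the duality
`⟨A, τ⟩ = ∫ (A, dτ)_HS` between continuous functions with values in the symmetric matrices and
measures. -/
def IsRuelleAdjoint {n d : ℕ} (ψ : Fin n → Euc d → Euc d) (G : Set (Euc d))
    (τ τ' : MatMeasure n d) : Prop :=
  ∀ A : ShiftSpace n → Mat d, Continuous A → (∀ x, (A x).IsSymmetric) →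
    hsIntegral A τ' = hsIntegral (ruelle ψ G A) τ

/-- `β > 0` is the eigenvalue of the Ruelle operator with the continuous eigenfunction `Q`, which
is positive definite everywhere, and `τ` is the positive eigenmeasure of the adjoint operator for
the same eigenvalue, normalised by `∫ (Q, dτ)_HS = 1`. -/
structure IsRuelleEigendata {n d : ℕ} (ψ : Fin n → Euc d → Euc d) (G : Set (Euc d))
    (β : ℝ) (Q : ShiftSpace n → Mat d) (τ : MatMeasure n d) : Prop where
  pos : 0 < β
  continuous_eigenfunction : Continuous Q
  posDef_eigenfunction : ∀ x, (Q x).IsSymmetric ∧ ∀ v, v ≠ 0 → 0 < inner ℝ (Q x v) v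
  eigenfunction : ruelle ψ G Q = β • Q
  posMeasure : IsPosMeasure τ
  normalised : hsIntegral Q τ = 1
  eigenmeasure : IsRuelleAdjoint ψ G τ (β • τ)

/-- The matrix `Dψ_{x₀ … x_{l-1}} μ(Σ) ᵗDψ_{x₀ … x_{l-1}}`, with the derivative of
`ψ_{x₀ … x_{l-1}}` evaluated at `p`. -/
def wordTransform {n d : ℕ} (ψ : Fin n → Euc d → Euc d) (μ : MatMeasure n d)
    (x : ShiftSpace n) (l : ℕ) (p : Euc d) : Mat d :=
  fderiv ℝ (wordMap ψ x l) p ∘L μ univ ∘L (fderiv ℝ (wordMap ψ x l) p)†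

/-- The positive matrix-valued measure `μ` is a Gibbs measure, for the affine system `ψ`, with
the constant `C`. The derivative of the affine map `ψ_{x₀ … x_{l-1}}` is constant; it is evaluated
at an arbitrary point `p`. The order is that of symmetric matrices: `X ≤ Y` if `Y - X` is positive
semidefinite. -/
def IsMatrixGibbs {n d : ℕ} (ψ : Fin n → Euc d → Euc d) (C : ℝ) (μ : MatMeasure n d) : Prop :=
  IsPosMeasure μ ∧ ∃ D₁ : ℝ, 0 < D₁ ∧ ∀ l : ℕ, 1 ≤ l → ∀ (x : ShiftSpace n) (p : Euc d),
    Real.exp (-C * l - D₁) • wordTransform ψ μ x l p ≤ μ (cyl x l) ∧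
    μ (cyl x l) ≤ Real.exp (-C * l + D₁) • wordTransform ψ μ x l p

end

open ContinuousLinearMap

/-! ### The Hilbert-Schmidt pairing -/

/-! The eigenmeasure equation is tested on the indicator of a cylinder times a constant symmetric
matrix `S`, which is continuous because cylinders are clopen. The Ruelle operator removes the first
symbol: only the branch `i = x 0` survives, and its derivative `L` is constant, so the result is the
indicator of the shifted cylinder times `L† ∘L S ∘L L` (`ruelle_indicator_cyl_succ`). Cyclicity of
the trace moves `L` onto the measure (`hsInner_adjoint_conj`), and symmetric `S` separate positive
matrices (`eq_of_hsInner_eq`); this gives the one-step formula. Iterating it with the chain rule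
gives an exact formula on every cylinder, of which the Gibbs bounds are a weakening. -/

theorem trace_adjoint_comp_self {d : ℕ} (A : Mat d) :
    LinearMap.trace ℝ (Euc d) (A† ∘L A).toLinearMap =
      ∑ i, ‖A (EuclideanSpace.basisFun (Fin d) ℝ i)‖ ^ 2 := by
  rw [LinearMap.trace_eq_sum_inner _ (EuclideanSpace.basisFun (Fin d) ℝ)]
  refine Finset.sum_congr rfl fun i _ => ?_
  change inner ℝ _ (adjoint A (A _)) = _
  rw [adjoint_inner_right, real_inner_self_eq_norm_sq]

theorem eq_zero_of_hsInner_self_eq_zero {d : ℕ} {A : Mat d} (h : hsInner d A A = 0) : A = 0 := by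
  rw [hsInner_apply, trace_adjoint_comp_self,
    Finset.sum_eq_zero_iff_of_nonneg fun i _ => by positivity] at h
  have hA : A.toLinearMap = 0 :=
    (EuclideanSpace.basisFun (Fin d) ℝ).toBasis.ext fun i => by simpa using h i (Finset.mem_univ i)
  exact ContinuousLinearMap.coe_inj.1 hA

theorem hsInner_adjoint_conj {d : ℕ} (L S T : Mat d) :
    hsInner d (L† ∘L S ∘L L) T = hsInner d S (L ∘L T ∘L L†) := by
  rw [hsInner_apply, hsInner_apply, adjoint_comp, adjoint_comp, adjoint_adjoint]
  have h₁ : (((L† ∘L S†) ∘L L) ∘L T).toLinearMap =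
      L†.toLinearMap ∘ₗ (S† ∘L L ∘L T).toLinearMap := rfl
  have h₂ : (S† ∘L L ∘L T ∘L L†).toLinearMap =
      (S† ∘L L ∘L T).toLinearMap ∘ₗ L†.toLinearMap := rfl
  rw [h₁, h₂, LinearMap.trace_comp_comm']

/-- The difference `A - B` is itself symmetric, so it is an admissible test matrix, and its
Hilbert-Schmidt norm vanishes. -/
theorem eq_of_hsInner_eq {d : ℕ} {A B : Mat d} (hA : A.IsPositive) (hB : B.IsPositive)
    (h : ∀ S : Mat d, S.IsSymmetric → hsInner d S A = hsInner d S B) : A = B := by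
  refine sub_eq_zero.1 (eq_zero_of_hsInner_self_eq_zero ?_)
  have hS : (A - B).IsSymmetric := (hA.isSelfAdjoint.sub hB.isSelfAdjoint).isSymmetric
  rw [map_sub (hsInner d (A - B)) A B, h _ hS, sub_self]

/-! ### Positive matrix-valued measures have finite variation -/

/-- A positive matrix is a sum of rank-one matrices built from vectors `u i`, each with norm and
trace both equal to `‖u i‖ ^ 2`; the triangle inequality does the rest. -/
theorem norm_le_trace_of_isPositive {d : ℕ} {T : Mat d} (hT : T.IsPositive) :
    ‖T‖ ≤ LinearMap.trace ℝ (Euc d) T.toLinearMap := by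
  obtain ⟨m, u, hu⟩ := isPositive_iff_eq_sum_rankOne.1 hT
  rw [hu]
  refine (norm_sum_le _ _).trans (le_of_eq ?_)
  simp_rw [toLinearMap_sum, map_sum]
  refine Finset.sum_congr rfl fun i _ => ?_
  rw [InnerProductSpace.trace_rankOne, real_inner_self_eq_norm_mul_norm]
  exact InnerProductSpace.norm_rankOne (𝕜 := ℝ) (u i) (u i)

/-- The scalar measure `φ ∘ μ` is a signed measure, hence of finite total variation, and it
dominates the variation of `μ`. -/
theorem isFiniteMeasure_variation_of_norm_le {X F : Type*} [MeasurableSpace X]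
    [NormedAddCommGroup F] [NormedSpace ℝ F] (μ : VectorMeasure X F) (φ : F →L[ℝ] ℝ)
    (h : ∀ B, MeasurableSet B → ‖μ B‖ ≤ φ (μ B)) : IsFiniteMeasure μ.variation := by
  let s : SignedMeasure X := μ.mapRange φ.toLinearMap.toAddMonoidHom φ.continuous
  have hfin : IsFiniteMeasure s.variation := by
    rw [← SignedMeasure.totalVariation_eq_variation, SignedMeasure.totalVariation]
    infer_instance
  refine isFiniteMeasure_of_le s.variation
    (VectorMeasure.variation_le_of_forall_enorm_le fun B hB => ?_)
  refine le_trans ?_ (VectorMeasure.enorm_measure_le_variation s B)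
  rw [enorm_le_iff_norm_le]
  exact (h B hB).trans (le_abs_self _)

theorem hsIntegral_indicator_const {n d : ℕ} {τ : MatMeasure n d} (hτ : IsPosMeasure τ)
    {B : Set (ShiftSpace n)} (hB : MeasurableSet B) (S : Mat d) :
    hsIntegral (B.indicator fun _ => S) τ = hsInner d S (τ B) := by
  -- Pairing with the identity is the trace. Finite variation makes the constant `S` integrable.
  have := isFiniteMeasure_variation_of_norm_le τ (hsInner d (.id ℝ (Euc d))) fun B hB => by
    rw [hsInner_apply, adjoint_id]
    exact norm_le_trace_of_isPositive (hτ B hB)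
  exact VectorMeasure.integral_indicator_const S hB

/-! ### Cylinders -/

theorem isClopen_cyl {n : ℕ} (x : ShiftSpace n) (l : ℕ) : IsClopen (cyl x l) := by
  rw [cyl, PiNat.cylinder_eq_pi]
  exact ⟨isClosed_set_pi fun _ _ => isClosed_discrete _,
    isOpen_set_pi (Finset.finite_toSet _) fun _ _ => isOpen_discrete _⟩

theorem cyl_zero {n : ℕ} (x : ShiftSpace n) : cyl x 0 = univ :=
  PiNat.cylinder_zero (E := fun _ => Fin n) x

theorem prepend_mem_cyl_succ {n : ℕ} (i : Fin n) (x y : ShiftSpace n) (l : ℕ) :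
    prepend i y ∈ cyl x (l + 1) ↔ i = x 0 ∧ y ∈ cyl (leftShift x) l := by
  rw [cyl, cyl, PiNat.mem_cylinder_iff, PiNat.mem_cylinder_iff]
  exact Nat.forall_lt_succ_left

/-! ### Affine systems -/

theorem IsAffineSystem.exists_hasFDerivAt {d n : ℕ} {ψ : Fin n → Euc d → Euc d}
    (h : IsAffineSystem ψ) (i : Fin n) : ∃ L : Mat d, ∀ p, HasFDerivAt (ψ i) L p := by
  obtain ⟨f, hf⟩ := h i
  refine ⟨f.linear.toContinuousLinearMap, fun p => ?_⟩
  have : ψ i = fun q => f.linear.toContinuousLinearMap q + f 0 := by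
    ext1 q
    rw [← hf, f.decomp]
    simp
  rw [this]
  exact (f.linear.toContinuousLinearMap.hasFDerivAt).add_const _

/-- `wordMap` grows at its innermost map, whereas the induction on cylinders peels off the outermost
one. -/
theorem wordMap_succ_eq_comp {d n : ℕ} (ψ : Fin n → Euc d → Euc d) (x : ShiftSpace n) (l : ℕ) :
    wordMap ψ x (l + 1) = ψ (x 0) ∘ wordMap ψ (leftShift x) l := by
  induction l with
  | zero => rfl
  | succ l ih => rw [wordMap, ih]; rfl

theorem IsAffineSystem.differentiable_wordMap {d n : ℕ} {ψ : Fin n → Euc d → Euc d}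
    (h : IsAffineSystem ψ) (x : ShiftSpace n) (l : ℕ) : Differentiable ℝ (wordMap ψ x l) := by
  induction l with
  | zero => exact differentiable_id
  | succ l ih =>
    obtain ⟨L, hL⟩ := h.exists_hasFDerivAt (x l)
    exact ih.comp fun p => (hL p).differentiableAt

theorem IsAffineSystem.wordTransform_succ {d n : ℕ} {ψ : Fin n → Euc d → Euc d}
    (h : IsAffineSystem ψ) (μ : MatMeasure n d) (x : ShiftSpace n) (l : ℕ) (p : Euc d) :
    wordTransform ψ μ x (l + 1) p =
      fderiv ℝ (ψ (x 0)) p ∘L wordTransform ψ μ (leftShift x) l p ∘L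
        (fderiv ℝ (ψ (x 0)) p)† := by
  obtain ⟨L, hL⟩ := h.exists_hasFDerivAt (x 0)
  have hd : fderiv ℝ (wordMap ψ x (l + 1)) p = L ∘L fderiv ℝ (wordMap ψ (leftShift x) l) p := by
    rw [wordMap_succ_eq_comp]
    -- The chain rule takes the outer derivative at the image of `p`; it is the same `L` everywhere.
    exact ((hL _).comp p (h.differentiable_wordMap _ l p).hasFDerivAt).fderiv
  rw [wordTransform, wordTransform, hd, (hL p).fderiv, adjoint_comp]
  rfl

/-! ### The eigenmeasure on cylinders -/

theorem ruelle_indicator_cyl_succ {d n : ℕ} {ψ : Fin n → Euc d → Euc d} {G : Set (Euc d)}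
    {x : ShiftSpace n} {L : Mat d} (hL : ∀ p, HasFDerivAt (ψ (x 0)) L p) (l : ℕ) (S : Mat d) :
    ruelle ψ G ((cyl x (l + 1)).indicator fun _ => S) =
      (cyl (leftShift x) l).indicator fun _ => L† ∘L S ∘L L := by
  ext1 y
  rw [ruelle, Finset.sum_eq_single (x 0)]
  · rw [(hL _).fderiv]
    by_cases hy : y ∈ cyl (leftShift x) l
    · rw [indicator_of_mem hy, indicator_of_mem ((prepend_mem_cyl_succ _ _ _ _).2 ⟨rfl, hy⟩)]
    · rw [indicator_of_notMem hy,
        indicator_of_notMem fun h => hy ((prepend_mem_cyl_succ _ _ _ _).1 h).2]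
      simp
  · intro i _ hi
    rw [indicator_of_notMem fun h => hi ((prepend_mem_cyl_succ _ _ _ _).1 h).1]
    simp
  · simp

theorem IsRuelleEigendata.apply_cyl_succ {d n : ℕ} {ψ : Fin n → Euc d → Euc d}
    {G : Set (Euc d)} {β : ℝ} {Q : ShiftSpace n → Mat d} {τ : MatMeasure n d}
    (hτ : IsRuelleEigendata ψ G β Q τ) (haff : IsAffineSystem ψ) (x : ShiftSpace n) (l : ℕ)
    (p : Euc d) :
    τ (cyl x (l + 1)) =
      β⁻¹ • (fderiv ℝ (ψ (x 0)) p ∘L τ (cyl (leftShift x) l) ∘L (fderiv ℝ (ψ (x 0)) p)†) := by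
  obtain ⟨L, hL⟩ := haff.exists_hasFDerivAt (x 0)
  have hmeas : ∀ (y : ShiftSpace n) k, MeasurableSet (cyl y k) :=
    fun y k => (isClopen_cyl y k).isOpen.measurableSet
  have hβτ : IsPosMeasure (β • τ) := fun B hB => (hτ.posMeasure B hB).smul_of_nonneg hτ.pos.le
  -- Clearing `β⁻¹` leaves the value of the positive measure `β • τ`, the one in the eigenmeasure
  -- equation.
  rw [(hL p).fderiv, eq_inv_smul_iff₀ hτ.pos.ne']
  refine eq_of_hsInner_eq (hβτ _ (hmeas x (l + 1)))
    ((hτ.posMeasure _ (hmeas _ l)).conj_adjoint L) fun S hS => ?_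
  have hcont : Continuous ((cyl x (l + 1)).indicator fun _ => S) :=
    continuous_const.indicator fun y hy => by simp [(isClopen_cyl x (l + 1)).frontier_eq] at hy
  have hsymm : ∀ y, ((cyl x (l + 1)).indicator (fun _ => S) y).IsSymmetric := fun y => by
    by_cases hy : y ∈ cyl x (l + 1)
    · rwa [indicator_of_mem hy]
    · rw [indicator_of_notMem hy]
      exact LinearMap.IsSymmetric.zero
  have h := hτ.eigenmeasure _ hcont hsymm
  rw [ruelle_indicator_cyl_succ hL, hsIntegral_indicator_const hβτ (hmeas _ _),
    hsIntegral_indicator_const hτ.posMeasure (hmeas _ _), hsInner_adjoint_conj] at h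
  exact h

theorem IsRuelleEigendata.apply_cyl {d n : ℕ} {ψ : Fin n → Euc d → Euc d}
    {G : Set (Euc d)} {β : ℝ} {Q : ShiftSpace n → Mat d} {τ : MatMeasure n d}
    (hτ : IsRuelleEigendata ψ G β Q τ) (haff : IsAffineSystem ψ) (x : ShiftSpace n) (l : ℕ)
    (p : Euc d) : τ (cyl x l) = (β ^ l)⁻¹ • wordTransform ψ τ x l p := by
  induction l generalizing x with
  | zero =>
    rw [cyl_zero, wordTransform, wordMap, fderiv_id, adjoint_id]
    simp
  | succ l ih =>
    rw [hτ.apply_cyl_succ haff x l p, ih, haff.wordTransform_succ, smul_comp, comp_smul, smul_smul,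
      pow_succ', mul_inv]

theorem IsPosMeasure.isPositive_wordTransform {d n : ℕ} {μ : MatMeasure n d}
    (hμ : IsPosMeasure μ) (ψ : Fin n → Euc d → Euc d) (x : ShiftSpace n) (l : ℕ) (p : Euc d) :
    (wordTransform ψ μ x l p).IsPositive :=
  (hμ univ MeasurableSet.univ).conj_adjoint _

theorem IsRuelleEigendata.isMatrixGibbs {d n : ℕ} {ψ : Fin n → Euc d → Euc d}
    {G : Set (Euc d)} {β : ℝ} {Q : ShiftSpace n → Mat d} {τ : MatMeasure n d}
    (hτ : IsRuelleEigendata ψ G β Q τ) (haff : IsAffineSystem ψ) :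
    IsMatrixGibbs ψ (Real.log β) τ := by
  have hexp : ∀ l : ℕ, (β ^ l)⁻¹ = Real.exp (-Real.log β * l) := fun l => by
    rw [neg_mul, Real.exp_neg, mul_comm, Real.exp_nat_mul, Real.exp_log hτ.pos]
  have hmono : ∀ {a b : ℝ}, a ≤ b → ∀ {W : Mat d}, W.IsPositive → a • W ≤ b • W := by
    intro a b hab W hW
    rw [ContinuousLinearMap.le_def, ← sub_smul]
    exact hW.smul_of_nonneg (sub_nonneg.2 hab)
  -- The cylinder formula is the case of equality with `D₁ = 0`, so any positive `D₁` works.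
  refine ⟨hτ.posMeasure, 1, one_pos, fun l _ x p => ?_⟩
  have hW := hτ.posMeasure.isPositive_wordTransform ψ x l p
  rw [hτ.apply_cyl haff x l p, hexp]
  exact ⟨hmono (Real.exp_le_exp.2 (by linarith)) hW, hmono (Real.exp_le_exp.2 (by linarith)) hW⟩

theorem corollary5p2 {d n : ℕ} (ψ : Fin n → Euc d → Euc d) (G : Set (Euc d))
    (hψ : IsContractiveSystem ψ) (hG : IsAttractor ψ G)
    (hfin : HasFiniteOverlaps ψ G) (hpcf : IsPostCriticallyFinite ψ G)
    (hopen : HasSeparatingOpens ψ G) (hnd : IsNondegenerate ψ G) (haff : IsAffineSystem ψ)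
    (β : ℝ) (Q : ShiftSpace n → Mat d) (τ : MatMeasure n d)
    (hτ : IsRuelleEigendata ψ G β Q τ) :
    (∀ (x : ShiftSpace n) (l : ℕ) (p : Euc d),
      τ (cyl x (l + 1)) =
        β⁻¹ • (fderiv ℝ (ψ (x 0)) p ∘L τ (cyl (leftShift x) l) ∘L (fderiv ℝ (ψ (x 0)) p)†)) ∧
    (∀ (x : ShiftSpace n) (l : ℕ) (p : Euc d),
      τ (cyl x (l + 1)) =
        (β ^ (l + 1))⁻¹ •
          (fderiv ℝ (wordMap ψ x (l + 1)) p ∘L τ univ ∘L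
            (fderiv ℝ (wordMap ψ x (l + 1)) p)†)) ∧
    IsMatrixGibbs ψ (Real.log β) τ := by
  exact ⟨hτ.apply_cyl_succ haff, fun x l p => hτ.apply_cyl haff x (l + 1) p,
    hτ.isMatrixGibbs haff⟩
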